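/- Let $X$ be a reflexive complex Banach space and let $(T(t))_{t\ge 0}$ be a $C_0$-semigroup of bounded linear operators on $X$ with infinitesimal generator $A$, with domain $D(A)$. Suppose that there exists $t_0>0$ such that $AT(t_0)$ is a bounded operator on $X$ (in particular $T(t_0)X\subseteq D(A)$), and that $A$ has the single valued extension property (SVEP): for every $\lambda_0\in\mathbb{C}$ and every open neighbourhood $U\subseteq\mathbb{C}$ of $\lambda_0$, the only analytic function $f:U\to D(A)$ with $(A-zI)f(z)=0$ for all $z\in U$ is $f\equiv 0$. Then for every $t>0$ $$\{e^{t\lambda} : \lambda\in\sigma_k(A)\}=\sigma_k(T(t))\setminus\{0\}.$$ Here a closed linear operator $S$ on $X$ is called semi-regular if its range $R(S)$ is closed and its null space satisfies $N(S)\subseteq\bigcap_{n\ge 0}R(S^n)$, and $\sigma_k(S)=\{\lambda\in\mathbb{C} : S-\lambda I \text{ is not semi-regular}\}$. -/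

import Mathlib

open Filter Topology
open scoped NNReal

/-- A strongly continuous (`C₀`) one-parameter semigroup `(T(t))_{t ≥ 0}` of bounded linear
operators on a complex normed space `X`. -/
structure C0Semigroup (X : Type*) [NormedAddCommGroup X] [NormedSpace ℂ X] where
  /-- the operators `T(t)`, `t ≥ 0` -/
  op : ℝ≥0 → X →L[ℂ] X
  op_zero : op 0 = ContinuousLinearMap.id ℂ X
  op_add : ∀ t s : ℝ≥0, op (t + s) = (op t).comp (op s)
  tendsto_zero : ∀ x : X, Tendsto (fun t : ℝ≥0 => op t x) (𝓝[>] 0) (𝓝 x)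

namespace C0Semigroup

variable {X : Type*} [NormedAddCommGroup X] [NormedSpace ℂ X]

/-- The difference quotient `(T(t)x - x) / t`. -/
noncomputable def quot (T : C0Semigroup X) (x : X) (t : ℝ≥0) : X :=
  ((t : ℝ) : ℂ)⁻¹ • (T.op t x - x)

theorem tendsto_quot_add (T : C0Semigroup X) {x y a b : X}
    (hx : Tendsto (T.quot x) (𝓝[>] 0) (𝓝 a)) (hy : Tendsto (T.quot y) (𝓝[>] 0) (𝓝 b)) :
    Tendsto (T.quot (x + y)) (𝓝[>] 0) (𝓝 (a + b)) := by
  refine (hx.add hy).congr fun t => ?_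
  simp only [quot, map_add, ← smul_add]
  congr 1
  abel

theorem tendsto_quot_smul (T : C0Semigroup X) (c : ℂ) {x a : X}
    (hx : Tendsto (T.quot x) (𝓝[>] 0) (𝓝 a)) :
    Tendsto (T.quot (c • x)) (𝓝[>] 0) (𝓝 (c • a)) := by
  refine (hx.const_smul c).congr fun t => ?_
  simp only [quot, map_smul, ← smul_sub]
  rw [smul_comm]

/-- The domain `D(A)` of the infinitesimal generator: all `x` for which
`lim_{t → 0+} (T(t)x - x) / t` exists. -/
noncomputable def generatorDomain (T : C0Semigroup X) : Submodule ℂ X where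
  carrier := {x | ∃ y, Tendsto (T.quot x) (𝓝[>] 0) (𝓝 y)}
  add_mem' := by
    rintro x y ⟨a, ha⟩ ⟨b, hb⟩
    exact ⟨a + b, T.tendsto_quot_add ha hb⟩
  zero_mem' := ⟨0, tendsto_const_nhds.congr fun t => by simp [quot]⟩
  smul_mem' := by
    rintro c x ⟨a, ha⟩
    exact ⟨c • a, T.tendsto_quot_smul c ha⟩

/-- The infinitesimal generator `A x = lim_{t → 0+} (T(t)x - x) / t`, `x ∈ D(A)`, as an unbounded
operator. -/
noncomputable def generator (T : C0Semigroup X) : X →ₗ.[ℂ] X where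
  domain := T.generatorDomain
  toFun :=
    { toFun := fun x => x.2.choose
      map_add' := fun x y => tendsto_nhds_unique (x + y).2.choose_spec
        (T.tendsto_quot_add x.2.choose_spec y.2.choose_spec)
      map_smul' := fun c x => tendsto_nhds_unique (c • x).2.choose_spec
        (T.tendsto_quot_smul c x.2.choose_spec) }

theorem mem_graph_generator_iff (T : C0Semigroup X) (x y : X) :
    (∃ h : x ∈ T.generator.domain, T.generator ⟨x, h⟩ = y) ↔
      Tendsto (T.quot x) (𝓝[>] 0) (𝓝 y) := by
  constructor
  · rintro ⟨h, rfl⟩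
    exact h.choose_spec
  · intro h
    have hx : x ∈ T.generator.domain := ⟨y, h⟩
    exact ⟨hx, tendsto_nhds_unique hx.choose_spec h⟩

end C0Semigroup

namespace LinearPMap

variable {X : Type*} [NormedAddCommGroup X] [NormedSpace ℂ X]

/-- The operator `A - z I` with domain `D(A)`. -/
def subScalar (A : X →ₗ.[ℂ] X) (z : ℂ) : X →ₗ.[ℂ] X where
  domain := A.domain
  toFun := A.toFun - z • A.domain.subtype

/-- The null space `N(A) = {x ∈ D(A) : A x = 0}`. -/
def nullSpace (A : X →ₗ.[ℂ] X) : Set X :=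
  {x | ∃ h : x ∈ A.domain, A ⟨x, h⟩ = 0}

/-- The range `R(Aⁿ)` of the `n`-th power of `A`, where `Aⁿ` has its natural domain
`D(Aⁿ) = {x : x, A x, …, Aⁿ⁻¹ x ∈ D(A)}`; thus `R(A⁰) = X` and
`R(Aⁿ⁺¹) = {A x : x ∈ D(A) ∩ R(Aⁿ)}`. -/
def rangePow (A : X →ₗ.[ℂ] X) : ℕ → Set X
  | 0 => Set.univ
  | n + 1 => {y | ∃ x : A.domain, (x : X) ∈ rangePow A n ∧ A x = y}

/-- `A` is semi-regular: `R(A)` is closed and `N(A) ⊆ R^∞(A) = ⋂ₙ R(Aⁿ)`. -/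
def IsSemiRegular (A : X →ₗ.[ℂ] X) : Prop :=
  _root_.IsClosed (Set.range A) ∧ A.nullSpace ⊆ ⋂ n : ℕ, A.rangePow n

/-- The semi-regular (Kato) spectrum `σ_k(A) = {z : A - z I is not semi-regular}`. -/
def katoSpectrum (A : X →ₗ.[ℂ] X) : Set ℂ :=
  {z | ¬ (A.subScalar z).IsSemiRegular}

/-- The single valued extension property of `A` at `z₀`: for every open neighbourhood `U` of `z₀`,
the only analytic `f : U → D(A)` with `(A - z I) f(z) = 0` for all `z ∈ U` is `f = 0`. -/
def HasSVEPAt (A : X →ₗ.[ℂ] X) (z₀ : ℂ) : Prop :=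
  ∀ U : Set ℂ, IsOpen U → z₀ ∈ U → ∀ f : ℂ → X, AnalyticOnNhd ℂ f U →
    (∀ z ∈ U, ∃ h : f z ∈ A.domain, A.subScalar z ⟨f z, h⟩ = 0) → ∀ z ∈ U, f z = 0

/-- The single valued extension property: `A` has it at every point of `ℂ`. -/
def HasSVEP (A : X →ₗ.[ℂ] X) : Prop :=
  ∀ z₀ : ℂ, A.HasSVEPAt z₀

/-- The operator `A S`, with `S` bounded and everywhere defined, is a bounded operator on `X`:
`S` maps `X` into `D(A)` and `x ↦ A (S x)` is a bounded linear map. -/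
def IsBoundedComp (A : X →ₗ.[ℂ] X) (S : X →L[ℂ] X) : Prop :=
  ∃ B : X →L[ℂ] X, ∀ x : X, ∃ h : S x ∈ A.domain, A ⟨S x, h⟩ = B x

end LinearPMap

/-- A bounded operator, viewed as an operator with domain `X`. -/
def ContinuousLinearMap.asPMap {X : Type*} [NormedAddCommGroup X] [NormedSpace ℂ X]
    (S : X →L[ℂ] X) : X →ₗ.[ℂ] X :=
  (S : X →ₗ[ℂ] X).toPMap ⊤

/-- `X` is reflexive: the canonical embedding of `X` into its bidual is onto. -/
def IsReflexiveSpace (X : Type*) [NormedAddCommGroup X] [NormedSpace ℂ X] : Prop :=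
  Function.Surjective (NormedSpace.inclusionInDoubleDual ℂ X)

/-! Write `I_a x = ∫₀ᵃ T(s)x ds`. Rescaling to `e^{-λs}T(s)` replaces `A` by `A - λ`, so each
inclusion reduces to comparing `A` with `T(t) - 1`.

If `T(t) - 1` is semi-regular, so is `A` (`isSemiRegular_generator`): `A I_t = T(t) - 1` and `I_t`
commutes with `A`, so `R((T(t) - 1)ⁿ) ⊆ R(Aⁿ)` and `N(A) ⊆ N(T(t) - 1)`. Closedness of the range is
pulled back through `I_t`, since `I_t y - t y` lies in `R(A)`.

Conversely, let `A - λ` be semi-regular whenever `e^{tλ} = 1`. SVEP makes each of these operators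
injective, because a kernel vector would extend to an analytic family of eigenvectors; with closed
range they are bounded below (`bounded_below_of_hasSVEPAt`). For `h = t/N`, factor `T(t) - 1 = ∏
(T(h) - ζ)` over `ζ^N = 1`. Each factor is bounded below (`exists_antilipschitzWith_op_sub`): beyond
`t₀` orbits are Lipschitz in operator norm, so for large `N` the integral `∫₀ʰ e^{-λs}T(s)z ds` is
close to a nonzero multiple of `z = T(mt)x`, while `A - λ` sends it to a multiple of `(T(h) - ζ)z`.
Hence `T(t) - 1` is bounded below and so semi-regular. -/

namespace C0Semigroup

variable {X : Type*} [NormedAddCommGroup X] [NormedSpace ℂ X]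

/-! ### Local boundedness and strong continuity -/

theorem op_add_apply (T : C0Semigroup X) (t s : ℝ≥0) (x : X) :
    T.op (t + s) x = T.op t (T.op s x) := by
  rw [T.op_add]; rfl

theorem op_zero_apply (T : C0Semigroup X) (x : X) : T.op 0 x = x := by
  rw [T.op_zero]; rfl

theorem op_comm (T : C0Semigroup X) (t s : ℝ≥0) (x : X) :
    T.op t (T.op s x) = T.op s (T.op t x) := by
  rw [← op_add_apply, add_comm, op_add_apply]

theorem op_nsmul (T : C0Semigroup X) (n : ℕ) (t : ℝ≥0) : T.op (n • t) = T.op t ^ n := by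
  induction n with
  | zero => simp [T.op_zero]; rfl
  | succ n ih => rw [succ_nsmul, T.op_add, ih, pow_succ]; rfl

theorem norm_op_zero_le (T : C0Semigroup X) : ‖T.op 0‖ ≤ 1 := by
  rw [T.op_zero]; exact ContinuousLinearMap.norm_id_le

/-- Otherwise the norms blow up along some `sₙ → 0+`, against Banach–Steinhaus, since the orbits
converge along that sequence. -/
theorem exists_bound_near_zero [CompleteSpace X] (T : C0Semigroup X) :
    ∃ δ : ℝ≥0, 0 < δ ∧ ∃ M : ℝ, 1 ≤ M ∧ ∀ s ≤ δ, ‖T.op s‖ ≤ M := by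
  by_contra! H
  have H' : ∀ n : ℕ, ∃ s ≤ (1 / ((n : ℝ≥0) + 1)), (n : ℝ) + 1 < ‖T.op s‖ := fun n =>
    H _ (by positivity) _ (by linarith [(Nat.cast_nonneg n : (0 : ℝ) ≤ n)])
  choose s hs hs' using H'
  have hpos : ∀ n, 0 < s n := by
    intro n
    rw [pos_iff_ne_zero]
    intro h0
    have := hs' n
    rw [h0] at this
    linarith [T.norm_op_zero_le, (Nat.cast_nonneg n : (0 : ℝ) ≤ n)]
  have hlim : Tendsto s atTop (𝓝[>] 0) := by
    refine tendsto_nhdsWithin_iff.2 ⟨?_, Eventually.of_forall hpos⟩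
    exact tendsto_of_tendsto_of_tendsto_of_le_of_le tendsto_const_nhds
      tendsto_one_div_add_atTop_nhds_zero_nat (fun _ => zero_le) hs
  obtain ⟨C, hC⟩ := banach_steinhaus (g := fun n => T.op (s n)) (fun x => by
    obtain ⟨C, hC⟩ := (((T.tendsto_zero x).comp hlim).norm).bddAbove_range
    exact ⟨C, fun n => hC ⟨n, rfl⟩⟩)
  obtain ⟨n, hn⟩ := exists_nat_gt C
  have h1 := hC n
  have h2 := hs' n
  linarith

theorem exists_bound [CompleteSpace X] (T : C0Semigroup X) (a : ℝ≥0) :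
    ∃ M : ℝ, 0 < M ∧ ∀ s ≤ a, ‖T.op s‖ ≤ M := by
  obtain ⟨δ, hδ, M, hM, hb⟩ := T.exists_bound_near_zero
  have key : ∀ n : ℕ, ∀ s ≤ n • δ, ‖T.op s‖ ≤ M ^ n := by
    intro n
    induction n with
    | zero =>
      intro s hs
      have : s = 0 := by simpa using hs
      rw [this, pow_zero]
      exact T.norm_op_zero_le
    | succ n ih =>
      intro s hs
      rcases le_total s δ with h | h
      · exact (hb s h).trans (le_self_pow₀ hM (by simp))
      · have h1 : s - δ ≤ n • δ := by
          rw [tsub_le_iff_right, ← succ_nsmul]; exact hs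
        have h2 : s = (s - δ) + δ := (tsub_add_cancel_of_le h).symm
        rw [h2, T.op_add, pow_succ]
        refine (ContinuousLinearMap.opNorm_comp_le _ _).trans ?_
        exact mul_le_mul (ih _ h1) (hb _ le_rfl) (norm_nonneg _) (by positivity)
  obtain ⟨n, hn⟩ := Archimedean.arch a hδ
  exact ⟨M ^ n, by positivity, fun s hs => key n s (hs.trans hn)⟩

theorem tendsto_op_nhds_zero (T : C0Semigroup X) (x : X) :
    Tendsto (fun t : ℝ≥0 => T.op t x) (𝓝 0) (𝓝 x) := by
  have h : (𝓝 (0 : ℝ≥0)) = 𝓝[>] 0 ⊔ pure 0 := by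
    rw [← nhdsWithin_singleton, ← nhdsWithin_union]
    have : Set.Ioi (0 : ℝ≥0) ∪ {0} = Set.univ := by
      ext s
      rcases eq_zero_or_pos s with h | h <;> simp [h]
    rw [this, nhdsWithin_univ]
  rw [h]
  refine (T.tendsto_zero x).sup ?_
  rw [tendsto_pure_left]
  intro s hs
  rw [op_zero_apply]
  exact mem_of_mem_nhds hs

theorem continuous_op_apply [CompleteSpace X] (T : C0Semigroup X) (x : X) :
    Continuous (fun t : ℝ≥0 => T.op t x) := by
  rw [continuous_iff_continuousAt]
  intro s
  obtain ⟨M, hM, hb⟩ := T.exists_bound (s + 1)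
  -- With truncated subtraction, `(s' - s) + (s - s')` is `|s' - s|`; this covers both one-sided
  -- limits at once.
  have h1 : Tendsto (fun s' : ℝ≥0 => M * ‖T.op ((s' - s) + (s - s')) x - x‖) (𝓝 s) (𝓝 0) := by
    have hc : Tendsto (fun s' : ℝ≥0 => (s' - s) + (s - s')) (𝓝 s) (𝓝 0) := by
      have : Continuous (fun s' : ℝ≥0 => (s' - s) + (s - s')) := by fun_prop
      simpa using this.tendsto s
    simpa using (((T.tendsto_op_nhds_zero x).comp hc).sub_const x).norm.const_mul M
  refine tendsto_iff_norm_sub_tendsto_zero.2 (squeeze_zero' (Eventually.of_forall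
    fun _ => norm_nonneg _) ?_ h1)
  have hn : ∀ᶠ s' in 𝓝 s, s' ≤ s + 1 :=
    (eventually_lt_nhds (lt_add_one s)).mono fun _ h => h.le
  filter_upwards [hn] with s' hs'
  rcases le_total s s' with h | h
  · have e : T.op s' x = T.op s (T.op (s' - s) x) := by
      rw [← op_add_apply, add_tsub_cancel_of_le h]
    rw [tsub_eq_zero_of_le h, add_zero, e, ← map_sub]
    exact (T.op s).le_of_opNorm_le (hb s (by simp)) _
  · have e : T.op s x = T.op s' (T.op (s - s') x) := by
      rw [← op_add_apply, add_tsub_cancel_of_le h]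
    rw [tsub_eq_zero_of_le h, zero_add, e, norm_sub_rev, ← map_sub]
    exact (T.op s').le_of_opNorm_le (hb s' hs') _

/-! ### Integrals of orbits -/

theorem continuous_orbit [CompleteSpace X] (T : C0Semigroup X) (x : X) :
    Continuous (fun s : ℝ => T.op s.toNNReal x) :=
  (T.continuous_op_apply x).comp continuous_real_toNNReal

theorem intervalIntegrable_orbit [CompleteSpace X] (T : C0Semigroup X) (x : X) (a b : ℝ) :
    IntervalIntegrable (fun s : ℝ => T.op s.toNNReal x) MeasureTheory.volume a b :=
  (T.continuous_orbit x).intervalIntegrable a b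

/-- The bounded operator `x ↦ ∫₀ᵃ T(s) x ds`. -/
noncomputable def orbitIntegral [CompleteSpace X] (T : C0Semigroup X) (a : ℝ≥0) : X →L[ℂ] X :=
  LinearMap.mkContinuousOfExistsBound
    { toFun := fun x => ∫ s in (0 : ℝ)..a, T.op s.toNNReal x
      map_add' := fun x y => by
        simp only [map_add]
        exact intervalIntegral.integral_add (T.intervalIntegrable_orbit x _ _)
          (T.intervalIntegrable_orbit y _ _)
      map_smul' := fun c x => by
        simp only [map_smul]
        exact intervalIntegral.integral_smul _ _ }
    (by
      obtain ⟨M, -, hb⟩ := T.exists_bound a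
      refine ⟨M * a, fun x => ?_⟩
      have := intervalIntegral.norm_integral_le_of_norm_le_const (a := (0 : ℝ)) (b := a)
        (f := fun s => T.op s.toNNReal x) (C := M * ‖x‖) (fun s hs => by
          rw [Set.uIoc_of_le a.coe_nonneg] at hs
          exact (T.op _).le_of_opNorm_le (hb _ (Real.toNNReal_le_iff_le_coe.2 hs.2)) _)
      rw [sub_zero, abs_of_nonneg a.coe_nonneg] at this
      calc _ ≤ M * ‖x‖ * a := this
        _ = _ := by ring)

theorem orbitIntegral_apply [CompleteSpace X] (T : C0Semigroup X) (a : ℝ≥0) (x : X) :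
    T.orbitIntegral a x = ∫ s in (0 : ℝ)..a, T.op s.toNNReal x := rfl

theorem norm_orbitIntegral_le [CompleteSpace X] (T : C0Semigroup X) {a : ℝ≥0} {x : X} {C : ℝ}
    (hC : ∀ s ≤ a, ‖T.op s x‖ ≤ C) : ‖T.orbitIntegral a x‖ ≤ C * a := by
  have := intervalIntegral.norm_integral_le_of_norm_le_const (a := (0 : ℝ)) (b := a)
    (f := fun s => T.op s.toNNReal x) (C := C) (fun s hs => by
      rw [Set.uIoc_of_le a.coe_nonneg] at hs
      exact hC _ (Real.toNNReal_le_iff_le_coe.2 hs.2))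
  rwa [sub_zero, abs_of_nonneg a.coe_nonneg] at this

theorem op_orbitIntegral [CompleteSpace X] (T : C0Semigroup X) (a b : ℝ≥0) (x : X) :
    T.op b (T.orbitIntegral a x) = T.orbitIntegral a (T.op b x) := by
  simp only [orbitIntegral_apply]
  rw [← (T.op b).intervalIntegral_comp_comm (T.intervalIntegrable_orbit x _ _)]
  simp only [T.op_comm b]

theorem orbitIntegral_add [CompleteSpace X] (T : C0Semigroup X) (a b : ℝ≥0) (x : X) :
    T.orbitIntegral (a + b) x = T.orbitIntegral a x + T.op a (T.orbitIntegral b x) := by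
  rw [orbitIntegral_apply, orbitIntegral_apply T b, orbitIntegral_apply T a,
    ← (T.op a).intervalIntegral_comp_comm (T.intervalIntegrable_orbit x _ _),
    ← intervalIntegral.integral_add_adjacent_intervals (T.intervalIntegrable_orbit x 0 a)
      (T.intervalIntegrable_orbit x a _)]
  congr 1
  have h := intervalIntegral.integral_comp_add_left (a := 0) (b := (b : ℝ))
    (fun s : ℝ => T.op s.toNNReal x) (a : ℝ)
  rw [add_zero] at h
  rw [NNReal.coe_add, ← h]
  refine intervalIntegral.integral_congr fun s hs => ?_
  rw [Set.uIcc_of_le b.coe_nonneg] at hs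
  rw [Real.toNNReal_add a.coe_nonneg hs.1, Real.toNNReal_coe, op_add_apply]

/-- The integral over `[0, a + b]` can be split at `a` or at `b`. Dividing by `b` and letting `b →
0` gives `A I_a = T(a) - 1`. -/
theorem op_sub_orbitIntegral_comm [CompleteSpace X] (T : C0Semigroup X) (a b : ℝ≥0) (x : X) :
    T.op b (T.orbitIntegral a x) - T.orbitIntegral a x =
      T.op a (T.orbitIntegral b x) - T.orbitIntegral b x := by
  have h1 := T.orbitIntegral_add a b x
  have h2 := T.orbitIntegral_add b a x
  rw [add_comm b a, h1] at h2
  rw [sub_eq_sub_iff_add_eq_add, add_comm, ← h2, add_comm]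

theorem tendsto_orbitIntegral_div [CompleteSpace X] (T : C0Semigroup X) (x : X) :
    Tendsto (fun h : ℝ≥0 => ((h : ℝ) : ℂ)⁻¹ • T.orbitIntegral h x) (𝓝[>] 0) (𝓝 x) := by
  have h1 : HasDerivAt (fun u : ℝ => ∫ s in (0 : ℝ)..u, T.op s.toNNReal x) x 0 := by
    have := ((T.continuous_orbit x).integral_hasStrictDerivAt 0 0).hasDerivAt
    simpa [op_zero_apply] using this
  have h2 := h1.hasDerivWithinAt (s := Set.Ioi 0)
  rw [hasDerivWithinAt_iff_tendsto_slope' (by simp)] at h2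
  have h3 : Tendsto (fun h : ℝ≥0 => (h : ℝ)) (𝓝[>] 0) (𝓝[>] 0) := by
    refine tendsto_nhdsWithin_iff.2 ⟨?_, ?_⟩
    · exact (NNReal.continuous_coe.tendsto' 0 0 rfl).mono_left nhdsWithin_le_nhds
    · filter_upwards [self_mem_nhdsWithin] with h hh
      exact hh
  refine (h2.comp h3).congr fun h => ?_
  simp only [Function.comp, slope, vsub_eq_sub, sub_zero, intervalIntegral.integral_same,
    orbitIntegral_apply]
  rw [← Complex.ofReal_inv]
  exact (Complex.coe_smul _ _).symm

/-! ### The generator: integral characterization, closedness, rescaling -/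

theorem tendsto_quot_orbitIntegral [CompleteSpace X] (T : C0Semigroup X) (a : ℝ≥0) (x : X) :
    Tendsto (T.quot (T.orbitIntegral a x)) (𝓝[>] 0) (𝓝 (T.op a x - x)) := by
  have := (((T.op a).continuous.tendsto x).comp (T.tendsto_orbitIntegral_div x)).sub
    (T.tendsto_orbitIntegral_div x)
  refine this.congr fun h => ?_
  simp only [Function.comp, quot, map_smul, ← smul_sub]
  rw [T.op_sub_orbitIntegral_comm]

theorem orbitIntegral_of_tendsto_quot [CompleteSpace X] (T : C0Semigroup X) (a : ℝ≥0) {x y : X}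
    (h : Tendsto (T.quot x) (𝓝[>] 0) (𝓝 y)) : T.orbitIntegral a y = T.op a x - x := by
  refine tendsto_nhds_unique (((T.orbitIntegral a).continuous.tendsto y).comp h) ?_
  refine (T.tendsto_quot_orbitIntegral a x).congr fun s => ?_
  simp only [Function.comp, quot, map_smul, map_sub, op_orbitIntegral]

theorem tendsto_quot_of_map (T : C0Semigroup X) {S : X →L[ℂ] X}
    (hS : ∀ s x, T.op s (S x) = S (T.op s x)) {x y : X}
    (h : Tendsto (T.quot x) (𝓝[>] 0) (𝓝 y)) : Tendsto (T.quot (S x)) (𝓝[>] 0) (𝓝 (S y)) := by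
  refine ((S.continuous.tendsto y).comp h).congr fun s => ?_
  simp only [Function.comp, quot, map_smul, map_sub, hS]

theorem mem_graph_generator (T : C0Semigroup X) {x y : X} :
    (x, y) ∈ T.generator.graph ↔ Tendsto (T.quot x) (𝓝[>] 0) (𝓝 y) := by
  rw [← mem_graph_generator_iff, LinearPMap.mem_graph_iff]
  simp

/-- This trades a limit for a family of closed conditions on `(x, y)`, so that the graph of the
generator is visibly closed. -/
theorem tendsto_quot_iff [CompleteSpace X] (T : C0Semigroup X) {x y : X} :
    Tendsto (T.quot x) (𝓝[>] 0) (𝓝 y) ↔ ∀ a, T.orbitIntegral a y = T.op a x - x := by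
  refine ⟨fun h a => T.orbitIntegral_of_tendsto_quot a h, fun h => ?_⟩
  refine (T.tendsto_orbitIntegral_div y).congr fun s => ?_
  rw [h]; rfl

theorem isClosed_generator [CompleteSpace X] (T : C0Semigroup X) : T.generator.IsClosed := by
  have : (T.generator.graph : Set (X × X)) =
      ⋂ a, {p | T.orbitIntegral a p.2 = T.op a p.1 - p.1} := by
    ext ⟨x, y⟩
    simp only [SetLike.mem_coe, mem_graph_generator, tendsto_quot_iff, Set.mem_iInter,
      Set.mem_ofPred_eq]
  rw [LinearPMap.IsClosed, this]
  refine isClosed_iInter fun a => isClosed_eq ?_ ?_ <;> fun_prop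

/-- The rescaled semigroup `e^{-λ s} T(s)`. -/
noncomputable def rescale (T : C0Semigroup X) (l : ℂ) : C0Semigroup X where
  op s := Complex.exp (-(l * ((s : ℝ) : ℂ))) • T.op s
  op_zero := by simp [T.op_zero]
  op_add t s := by
    rw [T.op_add]
    ext x
    simp only [_root_.smul_apply, ContinuousLinearMap.comp_apply, map_smul, smul_smul,
      ← Complex.exp_add, NNReal.coe_add, Complex.ofReal_add]
    congr 2
    ring
  tendsto_zero x := by
    have h : Continuous (fun s : ℝ≥0 => Complex.exp (-(l * ((s : ℝ) : ℂ)))) := by fun_prop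
    simpa using ((h.tendsto 0).mono_left nhdsWithin_le_nhds).smul (T.tendsto_zero x)

theorem rescale_op_apply (T : C0Semigroup X) (l : ℂ) (s : ℝ≥0) (x : X) :
    (T.rescale l).op s x = Complex.exp (-(l * ((s : ℝ) : ℂ))) • T.op s x := rfl

theorem rescale_rescale (T : C0Semigroup X) (l m : ℂ) :
    (T.rescale l).rescale m = T.rescale (l + m) := by
  simp only [rescale, smul_smul, ← Complex.exp_add]
  congr 1
  funext s
  congr 2
  ring

theorem rescale_zero (T : C0Semigroup X) : T.rescale 0 = T := by
  simp [rescale]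

theorem tendsto_quot_rescale_of (T : C0Semigroup X) (l : ℂ) {x y : X}
    (h : Tendsto (T.quot x) (𝓝[>] 0) (𝓝 y)) :
    Tendsto ((T.rescale l).quot x) (𝓝[>] 0) (𝓝 (y - l • x)) := by
  have h1 : HasDerivAt (fun u : ℝ => Complex.exp (-(l * (u : ℂ)))) (-l) 0 := by
    have h0 : HasDerivAt (fun u : ℂ => Complex.exp (-(l * u))) (-l) ((0 : ℝ) : ℂ) := by
      have := (((hasDerivAt_id ((0 : ℝ) : ℂ)).const_mul l).neg).cexp
      simpa using this
    exact h0.comp_ofReal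
  have h2 := h1.hasDerivWithinAt (s := Set.Ioi 0)
  rw [hasDerivWithinAt_iff_tendsto_slope' (by simp)] at h2
  have h3 : Tendsto (fun h : ℝ≥0 => (h : ℝ)) (𝓝[>] 0) (𝓝[>] 0) := by
    refine tendsto_nhdsWithin_iff.2 ⟨?_, ?_⟩
    · exact (NNReal.continuous_coe.tendsto' 0 0 rfl).mono_left nhdsWithin_le_nhds
    · filter_upwards [self_mem_nhdsWithin] with h hh
      exact hh
  have h4 : Tendsto (fun s : ℝ≥0 => Complex.exp (-(l * ((s : ℝ) : ℂ)))) (𝓝[>] 0) (𝓝 1) := by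
    have h : Continuous (fun s : ℝ≥0 => Complex.exp (-(l * ((s : ℝ) : ℂ)))) := by fun_prop
    simpa using ((h.tendsto 0).mono_left nhdsWithin_le_nhds)
  have h5 := (h4.smul h).add ((h2.comp h3).smul_const x)
  rw [one_smul, neg_smul, ← sub_eq_add_neg] at h5
  refine h5.congr fun s => ?_
  simp only [Function.comp, slope, vsub_eq_sub, sub_zero, quot, rescale_op_apply]
  rw [← Complex.coe_smul (s : ℝ)⁻¹]
  simp only [Complex.ofReal_inv, Complex.ofReal_zero, mul_zero, neg_zero, Complex.exp_zero,
    smul_eq_mul]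
  module

theorem tendsto_quot_rescale_iff (T : C0Semigroup X) (l : ℂ) {x y : X} :
    Tendsto ((T.rescale l).quot x) (𝓝[>] 0) (𝓝 y) ↔
      Tendsto (T.quot x) (𝓝[>] 0) (𝓝 (y + l • x)) := by
  constructor
  · intro h
    have := (T.rescale l).tendsto_quot_rescale_of (-l) h
    rwa [rescale_rescale, add_neg_cancel, rescale_zero, neg_smul, sub_neg_eq_add] at this
  · intro h
    simpa using T.tendsto_quot_rescale_of l h

theorem generator_rescale (T : C0Semigroup X) (l : ℂ) :
    (T.rescale l).generator = T.generator.subScalar l := by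
  apply LinearPMap.eq_of_eq_graph
  ext ⟨x, y⟩
  rw [mem_graph_generator, tendsto_quot_rescale_iff, ← mem_graph_generator,
    LinearPMap.mem_graph_iff, LinearPMap.mem_graph_iff]
  constructor
  · rintro ⟨z, h1, h2⟩
    refine ⟨z, h1, ?_⟩
    change T.generator z - l • (z : X) = y
    simp only at h1 h2
    rw [h2, h1]; abel
  · rintro ⟨z, h1, h2⟩
    refine ⟨z, h1, ?_⟩
    change T.generator z - l • (z : X) = y at h2
    simp only at h1 ⊢
    rw [← h2, ← h1]; abel

end C0Semigroup

/-! ### Semi-regular closed operators and SVEP -/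

namespace LinearPMap

variable {X : Type*} [NormedAddCommGroup X] [NormedSpace ℂ X]

theorem subScalar_subScalar (A : X →ₗ.[ℂ] X) (l m : ℂ) :
    (A.subScalar l).subScalar m = A.subScalar (l + m) := by
  refine LinearPMap.ext rfl fun x hx hx' => ?_
  change A ⟨x, _⟩ - l • x - m • x = A ⟨x, _⟩ - (l + m) • x
  module

theorem mem_range_iff_graph (S : X →ₗ.[ℂ] X) {y : X} :
    y ∈ Set.range S ↔ ∃ x, (x, y) ∈ S.graph := by
  constructor
  · rintro ⟨x, rfl⟩
    exact ⟨x, S.mem_graph x⟩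
  · rintro ⟨x, h⟩
    obtain ⟨z, -, h⟩ := (LinearPMap.mem_graph_iff S).1 h
    exact ⟨z, h⟩

theorem mem_nullSpace_iff_graph (S : X →ₗ.[ℂ] X) {x : X} :
    x ∈ S.nullSpace ↔ (x, (0 : X)) ∈ S.graph := by
  rw [LinearPMap.mem_graph_iff]
  simp [nullSpace]

theorem mem_rangePow_succ_iff_graph (S : X →ₗ.[ℂ] X) {n : ℕ} {y : X} :
    y ∈ S.rangePow (n + 1) ↔ ∃ x ∈ S.rangePow n, (x, y) ∈ S.graph := by
  constructor
  · rintro ⟨x, hx, rfl⟩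
    exact ⟨x, hx, S.mem_graph x⟩
  · rintro ⟨x, hx, h⟩
    obtain ⟨z, h1, h⟩ := (LinearPMap.mem_graph_iff S).1 h
    simp only at h1 h
    exact ⟨z, by rwa [h1], h⟩

theorem zero_mem_rangePow (S : X →ₗ.[ℂ] X) (n : ℕ) : (0 : X) ∈ S.rangePow n := by
  induction n with
  | zero => trivial
  | succ n ih => exact S.mem_rangePow_succ_iff_graph.2 ⟨0, ih, S.graph.zero_mem⟩

theorem add_mem_rangePow (S : X →ₗ.[ℂ] X) (n : ℕ) {x y : X} (hx : x ∈ S.rangePow n)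
    (hy : y ∈ S.rangePow n) : x + y ∈ S.rangePow n := by
  induction n generalizing x y with
  | zero => trivial
  | succ n ih =>
    obtain ⟨u, hu, hu'⟩ := S.mem_rangePow_succ_iff_graph.1 hx
    obtain ⟨v, hv, hv'⟩ := S.mem_rangePow_succ_iff_graph.1 hy
    exact S.mem_rangePow_succ_iff_graph.2 ⟨u + v, ih hu hv, S.graph.add_mem hu' hv'⟩

/-- A closed operator with closed range has preimages of controlled norm. -/
theorem exists_preimage_norm_le [CompleteSpace X] {S : X →ₗ.[ℂ] X} (hS : S.IsClosed)
    (hR : _root_.IsClosed (Set.range S)) :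
    ∃ C : ℝ, 0 < C ∧ ∀ y ∈ Set.range S, ∃ x, (x, y) ∈ S.graph ∧ ‖x‖ ≤ C * ‖y‖ := by
  have : CompleteSpace S.graph := IsClosed.completeSpace_coe (hs := hS)
  let R : Submodule ℂ X := LinearMap.range S.toFun
  have hR' : _root_.IsClosed (R : Set X) := hR
  have : CompleteSpace R := IsClosed.completeSpace_coe (hs := hR')
  let p : S.graph →L[ℂ] R := ((ContinuousLinearMap.snd ℂ X X).comp S.graph.subtypeL).codRestrict R
    (fun g => S.mem_range_iff_graph.2 ⟨g.1.1, g.2⟩)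
  have hp : Function.Surjective p := by
    rintro ⟨y, hy⟩
    obtain ⟨x, hx⟩ := S.mem_range_iff_graph.1 hy
    exact ⟨⟨(x, y), hx⟩, rfl⟩
  obtain ⟨C, hC, h⟩ := p.exists_preimage_norm_le hp
  refine ⟨C, hC, fun y hy => ?_⟩
  obtain ⟨g, hg, hn⟩ := h ⟨y, hy⟩
  have hg' : g.1.2 = y := congrArg Subtype.val hg
  refine ⟨g.1.1, hg' ▸ g.2, (norm_fst_le g.1).trans hn⟩

/-- The kernel vectors of a closed semi-regular operator extend to local analytic sections. -/
theorem exists_analytic_section [CompleteSpace X] {S : X →ₗ.[ℂ] X} (hS : S.IsClosed)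
    (hsr : S.IsSemiRegular) {x₀ : X} (hx₀ : x₀ ∈ S.nullSpace) :
    ∃ r : ℝ, 0 < r ∧ ∃ g : ℂ → X, AnalyticOnNhd ℂ g (Metric.ball 0 r) ∧ g 0 = x₀ ∧
      ∀ w ∈ Metric.ball (0 : ℂ) r, (g w, w • g w) ∈ S.graph := by
  obtain ⟨C, hC, hpre⟩ := exists_preimage_norm_le hS hsr.1
  -- `S` maps `R^∞` onto itself with norm control: any preimage differs from one in `R(Sⁿ)` by a
  -- kernel vector, which is in `R(Sⁿ)` by semi-regularity.
  have step : ∀ y ∈ ⋂ n, S.rangePow n, ∃ x ∈ ⋂ n, S.rangePow n,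
      (x, y) ∈ S.graph ∧ ‖x‖ ≤ C * ‖y‖ := by
    intro y hy
    rw [Set.mem_iInter] at hy
    obtain ⟨u, -, hu⟩ := S.mem_rangePow_succ_iff_graph.1 (hy 1)
    obtain ⟨x, hx, hn⟩ := hpre y (S.mem_range_iff_graph.2 ⟨u, hu⟩)
    refine ⟨x, Set.mem_iInter.2 fun n => ?_, hx, hn⟩
    obtain ⟨v, hv, hv'⟩ := S.mem_rangePow_succ_iff_graph.1 (hy (n + 1))
    have h0 : x - v ∈ S.nullSpace := by
      have := S.graph.sub_mem hx hv'
      rw [Prod.mk_sub_mk, sub_self] at this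
      exact S.mem_nullSpace_iff_graph.2 this
    have := S.add_mem_rangePow n (Set.mem_iInter.1 (hsr.2 h0) n) hv
    rwa [sub_add_cancel] at this
  choose! nxt h1 h2 h3 using step
  -- A backward orbit `S a_{n+1} = a_n` starting at the kernel vector, growing at most like `Cⁿ`;
  -- the section is `∑ wⁿ a_n`.
  let a : ℕ → X := fun n => nxt^[n] x₀
  have ha : ∀ n, a n ∈ ⋂ n, S.rangePow n := by
    intro n
    induction n with
    | zero => exact hsr.2 hx₀
    | succ n ih =>
      simp only [a, Function.iterate_succ_apply']
      exact h1 _ ih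
  have hgr : ∀ n, (a (n + 1), a n) ∈ S.graph := fun n => by
    simp only [a, Function.iterate_succ_apply']
    exact h2 _ (ha n)
  have hnorm : ∀ n, ‖a n‖ ≤ C ^ n * ‖x₀‖ := by
    intro n
    induction n with
    | zero => simp [a]
    | succ n ih =>
      have : ‖a (n + 1)‖ ≤ C * ‖a n‖ := by
        simp only [a, Function.iterate_succ_apply']
        exact h3 _ (ha n)
      calc _ ≤ C * ‖a n‖ := this
        _ ≤ C * (C ^ n * ‖x₀‖) := by gcongr
        _ = _ := by ring
  have hsum : Summable fun n : ℕ => (1 / 2 : ℝ) ^ n * ‖x₀‖ :=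
    (summable_geometric_two).mul_right _
  have hterm : ∀ n : ℕ, ∀ w ∈ Metric.ball (0 : ℂ) (1 / (2 * C)),
      ‖w ^ n • a n‖ ≤ (1 / 2 : ℝ) ^ n * ‖x₀‖ := by
    intro n w hw
    rw [mem_ball_zero_iff] at hw
    rw [norm_smul, norm_pow]
    calc _ ≤ (1 / (2 * C)) ^ n * (C ^ n * ‖x₀‖) := by
          gcongr
          exact hnorm n
      _ = _ := by
          rw [← mul_assoc, ← mul_pow]
          congr 2
          field_simp
  refine ⟨1 / (2 * C), by positivity, fun w => ∑' n, w ^ n • a n, ?_, ?_, ?_⟩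
  · refine DifferentiableOn.analyticOnNhd ?_ Metric.isOpen_ball
    refine Complex.differentiableOn_tsum_of_summable_norm hsum (fun n => ?_) Metric.isOpen_ball hterm
    fun_prop
  · simp only
    rw [tsum_eq_single 0 (fun n hn => by simp [hn])]
    simp [a]
  · intro w hw
    have hs : HasSum (fun n => w ^ n • a n) (∑' n, w ^ n • a n) :=
      (Summable.of_norm_bounded hsum fun n => hterm n w hw).hasSum
    have ht := hs.tendsto_sum_nat
    -- Since `S a_0 = 0`, applying `S` shifts the sum by one, hence `N + 1` terms against `N`.
    -- Closedness of the graph then passes to the limit.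
    have hmem : ∀ N, (∑ n ∈ Finset.range (N + 1), w ^ n • a n,
        w • ∑ n ∈ Finset.range N, w ^ n • a n) ∈ S.graph := by
      intro N
      induction N with
      | zero =>
        simpa [a] using S.mem_nullSpace_iff_graph.1 hx₀
      | succ N ih =>
        rw [Finset.sum_range_succ, Finset.sum_range_succ (fun n => w ^ n • a n) N, smul_add, smul_smul,
          ← pow_succ', ← Finset.sum_range_succ (fun n => w ^ n • a n) N]
        have := S.graph.add_mem ih (S.graph.smul_mem (w ^ (N + 1)) (hgr N))
        exact this
    exact hS.mem_of_tendsto ((ht.comp (tendsto_add_atTop_nat 1)).prodMk_nhds (ht.const_smul w))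
      (Eventually.of_forall hmem)

/-- A closed semi-regular `A - λ` is bounded below if `A` has the single valued extension property
at `λ`. -/
theorem bounded_below_of_hasSVEPAt [CompleteSpace X] {A : X →ₗ.[ℂ] X} {l : ℂ}
    (hS : (A.subScalar l).IsClosed) (hsr : (A.subScalar l).IsSemiRegular) (hA : A.HasSVEPAt l) :
    ∃ C : ℝ, 0 < C ∧ ∀ x y, (x, y) ∈ (A.subScalar l).graph → ‖x‖ ≤ C * ‖y‖ := by
  have inj : ∀ x, (x, (0 : X)) ∈ (A.subScalar l).graph → x = 0 := by
    intro x hx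
    obtain ⟨r, hr, g, hg, hg0, hgr⟩ :=
      exists_analytic_section hS hsr ((mem_nullSpace_iff_graph _).2 hx)
    have hsub : ∀ z ∈ Metric.ball l r, z - l ∈ Metric.ball (0 : ℂ) r := fun z hz => by
      simpa [dist_eq_norm] using hz
    have := hA (Metric.ball l r) Metric.isOpen_ball (Metric.mem_ball_self hr)
      (fun z => g (z - l)) (hg.comp (fun z _ => by fun_prop) hsub) (fun z hz => by
        obtain ⟨u, h1, h2⟩ := (LinearPMap.mem_graph_iff _).1 (hgr _ (hsub z hz))
        simp only at h1 h2
        refine ⟨h1 ▸ u.2, ?_⟩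
        have h2' : A u - l • (u : X) = (z - l) • g (z - l) := h2
        have h3 : (⟨g (z - l), h1 ▸ u.2⟩ : A.domain) = u := Subtype.ext h1.symm
        change A ⟨g (z - l), _⟩ - z • g (z - l) = 0
        rw [h3, ← sub_eq_zero.2 h2', h1]
        module) l (Metric.mem_ball_self hr)
    simpa [hg0] using this
  obtain ⟨C, hC, h⟩ := exists_preimage_norm_le hS hsr.1
  refine ⟨C, hC, fun x y hxy => ?_⟩
  obtain ⟨x', hx', hn⟩ := h y ((mem_range_iff_graph _).2 ⟨x, hxy⟩)
  have h0 : x - x' = 0 := by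
    refine inj _ ?_
    have := (A.subScalar l).graph.sub_mem hxy hx'
    rwa [Prod.mk_sub_mk, sub_self] at this
  rwa [sub_eq_zero.1 h0]

end LinearPMap

theorem ContinuousLinearMap.mem_graph_asPMap_subScalar {X : Type*} [NormedAddCommGroup X]
    [NormedSpace ℂ X] (S : X →L[ℂ] X) (m : ℂ) {x y : X} :
    (x, y) ∈ (S.asPMap.subScalar m).graph ↔ S x - m • x = y := by
  rw [LinearPMap.mem_graph_iff]
  constructor
  · rintro ⟨z, h1, h2⟩
    simp only at h1 h2
    rw [← h2, ← h1]; rfl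
  · intro h
    exact ⟨⟨x, trivial⟩, rfl, h⟩

theorem ContinuousLinearMap.isSemiRegular_of_bounded_below {X : Type*} [NormedAddCommGroup X]
    [NormedSpace ℂ X] [CompleteSpace X] (S : X →L[ℂ] X) (m : ℂ) {C : ℝ}
    (h : ∀ x, ‖x‖ ≤ C * ‖S x - m • x‖) : (S.asPMap.subScalar m).IsSemiRegular := by
  constructor
  · have hr : Set.range (S.asPMap.subScalar m) =
        Set.range (S - m • ContinuousLinearMap.id ℂ X) := by
      ext y
      rw [LinearPMap.mem_range_iff_graph]
      simp only [mem_graph_asPMap_subScalar]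
      rfl
    rw [hr]
    refine AntilipschitzWith.isClosed_range (K := C.toNNReal)
      (AddMonoidHomClass.antilipschitz_of_bound _ fun x => (h x).trans ?_)
      (ContinuousLinearMap.uniformContinuous _)
    exact mul_le_mul_of_nonneg_right (Real.le_coe_toNNReal C) (norm_nonneg _)
  · intro x hx
    rw [LinearPMap.mem_nullSpace_iff_graph, mem_graph_asPMap_subScalar] at hx
    have := h x
    rw [hx, norm_zero, mul_zero, norm_le_zero_iff] at this
    rw [this]
    exact Set.mem_iInter.2 fun n => LinearPMap.zero_mem_rangePow _ n

/-! ### From `T(a) - 1` to the generator -/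

namespace C0Semigroup

variable {X : Type*} [NormedAddCommGroup X] [NormedSpace ℂ X]

theorem map_mem_graph_generator (T : C0Semigroup X) {S : X →L[ℂ] X}
    (hS : ∀ s x, T.op s (S x) = S (T.op s x)) {x y : X} (h : (x, y) ∈ T.generator.graph) :
    (S x, S y) ∈ T.generator.graph :=
  T.mem_graph_generator.2 (T.tendsto_quot_of_map hS (T.mem_graph_generator.1 h))

variable [CompleteSpace X]

theorem orbitIntegral_mem_graph (T : C0Semigroup X) (a : ℝ≥0) (x : X) :
    (T.orbitIntegral a x, T.op a x - x) ∈ T.generator.graph :=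
  T.mem_graph_generator.2 (T.tendsto_quot_orbitIntegral a x)

theorem orbitIntegral_of_mem_graph (T : C0Semigroup X) (a : ℝ≥0) {x y : X}
    (h : (x, y) ∈ T.generator.graph) : T.orbitIntegral a y = T.op a x - x :=
  T.orbitIntegral_of_tendsto_quot a (T.mem_graph_generator.1 h)

theorem continuous_orbitIntegral_toNNReal (T : C0Semigroup X) (x : X) :
    Continuous (fun s : ℝ => T.orbitIntegral s.toNNReal x) := by
  have h : Continuous (fun u : ℝ => ∫ s in (0 : ℝ)..u, T.op s.toNNReal x) :=
    intervalIntegral.continuous_primitive (fun a b => T.intervalIntegrable_orbit x a b) 0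
  exact h.comp (NNReal.continuous_coe.comp continuous_real_toNNReal)

/-- Integrating `A I_s x = T(s)x - x` over `[0, a]` gives the witness `∫₀ᵃ I_s x ds`. Thus `I_a` is
`a` times the identity modulo `R(A)`. -/
theorem exists_mem_graph_orbitIntegral_sub (T : C0Semigroup X) (a : ℝ≥0) (x : X) :
    ∃ d, (d, T.orbitIntegral a x - (a : ℝ) • x) ∈ T.generator.graph := by
  refine ⟨∫ s in (0 : ℝ)..a, T.orbitIntegral s.toNNReal x, T.mem_graph_generator.2 ?_⟩
  have h1 := (((T.orbitIntegral a).continuous.tendsto x).comp (T.tendsto_orbitIntegral_div x)).sub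
    ((T.tendsto_orbitIntegral_div x).const_smul (a : ℝ))
  refine h1.congr fun h => ?_
  have hi := (T.continuous_orbitIntegral_toNNReal x).intervalIntegrable
    (μ := MeasureTheory.volume) 0 a
  have hi' : IntervalIntegrable (fun s : ℝ => T.op h (T.orbitIntegral s.toNNReal x))
      MeasureTheory.volume 0 a :=
    ((T.op h).continuous.comp (T.continuous_orbitIntegral_toNNReal x)).intervalIntegrable 0 a
  have key : T.op h (∫ s in (0 : ℝ)..a, T.orbitIntegral s.toNNReal x) -
      (∫ s in (0 : ℝ)..a, T.orbitIntegral s.toNNReal x) =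
      T.orbitIntegral a (T.orbitIntegral h x) - (a : ℝ) • T.orbitIntegral h x := by
    rw [← (T.op h).intervalIntegral_comp_comm hi, ← intervalIntegral.integral_sub hi' hi]
    have e := fun s : ℝ => T.op_sub_orbitIntegral_comm s.toNNReal h x
    simp only [e]
    rw [intervalIntegral.integral_sub (T.intervalIntegrable_orbit _ _ _)
      intervalIntegrable_const, intervalIntegral.integral_const, sub_zero,
      orbitIntegral_apply T a]
  simp only [quot, key, Function.comp, map_smul, smul_sub]
  rw [smul_comm]

/-- If `T(a) - 1` (up to a nonzero factor) is semi-regular, so is the generator. -/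
theorem isSemiRegular_generator (T : C0Semigroup X) {a : ℝ≥0} (ha : 0 < a) {c : ℂ}
    {P : X →ₗ.[ℂ] X} (hP : ∀ x y, (x, y) ∈ P.graph ↔ c • (T.op a x - x) = y)
    (h : P.IsSemiRegular) (hc : c ≠ 0) : T.generator.IsSemiRegular := by
  have hcomm : ∀ s x, T.op s (T.orbitIntegral a x) = T.orbitIntegral a (T.op s x) :=
    fun s x => T.op_orbitIntegral a s x
  have hsub : ∀ n, ∀ y ∈ P.rangePow n, y ∈ T.generator.rangePow n := by
    intro n
    induction n with
    | zero => intro y _; trivial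
    | succ n ih =>
      intro y hy
      obtain ⟨x, hx, hxy⟩ := P.mem_rangePow_succ_iff_graph.1 hy
      rw [hP] at hxy
      have hB : ∀ n, ∀ y ∈ T.generator.rangePow n,
          c • T.orbitIntegral a y ∈ T.generator.rangePow n := by
        intro n
        induction n with
        | zero => intro y _; trivial
        | succ n ihn =>
          intro y hy
          obtain ⟨x, hx, hxy⟩ := T.generator.mem_rangePow_succ_iff_graph.1 hy
          exact T.generator.mem_rangePow_succ_iff_graph.2 ⟨_, ihn x hx,
            T.generator.graph.smul_mem c (T.map_mem_graph_generator hcomm hxy)⟩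
      refine T.generator.mem_rangePow_succ_iff_graph.2 ⟨_, hB n x (ih x hx), ?_⟩
      rw [← hxy]
      exact T.generator.graph.smul_mem c (T.orbitIntegral_mem_graph a x)
  constructor
  · refine isClosed_of_closure_subset fun y hy => ?_
    -- As `I_a A x = T(a)x - x`, continuity of `I_a` carries the closure of `R(A)` into the closed
    -- range of `P`.
    have hmaps : Set.MapsTo (c • T.orbitIntegral a) (Set.range T.generator) (Set.range P) := by
      rintro _ ⟨x, rfl⟩
      refine P.mem_range_iff_graph.2 ⟨x, (hP _ _).2 ?_⟩
      rw [← T.orbitIntegral_of_mem_graph a (T.generator.mem_graph x)]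
      rfl
    have h1 := map_mem_closure (c • T.orbitIntegral a).continuous hy hmaps
    rw [h.1.closure_eq, LinearPMap.mem_range_iff_graph] at h1
    obtain ⟨u, hu⟩ := h1
    rw [hP] at hu
    have hu' : T.op a u - u = T.orbitIntegral a y := smul_right_injective X hc hu
    obtain ⟨d, hd⟩ := T.exists_mem_graph_orbitIntegral_sub a y
    -- Here `A I_a u = I_a y` and `A d = I_a y - a y`, so `A (I_a u - d) = a y`.
    have h2 := T.generator.graph.sub_mem (T.orbitIntegral_mem_graph a u) hd
    rw [hu', Prod.mk_sub_mk, sub_sub_cancel] at h2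
    have h3 := T.generator.graph.smul_mem (((a : ℝ) : ℂ)⁻¹) h2
    have ha' : ((a : ℝ) : ℂ) ≠ 0 := by
      simpa using ha.ne'
    rw [Prod.smul_mk, ← Complex.coe_smul (a : ℝ), inv_smul_smul₀ ha'] at h3
    exact T.generator.mem_range_iff_graph.2 ⟨_, h3⟩
  · intro x hx
    rw [LinearPMap.mem_nullSpace_iff_graph] at hx
    have h1 := T.orbitIntegral_of_mem_graph a hx
    rw [map_zero] at h1
    have h2 : x ∈ P.nullSpace := by
      rw [LinearPMap.mem_nullSpace_iff_graph, hP, ← h1, smul_zero]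
    have h3 := Set.mem_iInter.1 (h.2 h2)
    exact Set.mem_iInter.2 fun n => hsub n x (h3 n)

end C0Semigroup

/-! ### Lower bounds for `T(t) - 1` -/

theorem exists_antilipschitzWith_pow_sub_one {X : Type*} [NormedAddCommGroup X] [NormedSpace ℂ X]
    (U : X →L[ℂ] X) {N : ℕ} (hN : 0 < N)
    (h : ∀ ζ : ℂ, ζ ^ N = 1 → ∃ K : ℝ≥0, AntilipschitzWith K (U - algebraMap ℂ (X →L[ℂ] X) ζ)) :
    ∃ K : ℝ≥0, AntilipschitzWith K (U ^ N - 1 : X →L[ℂ] X) := by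
  have hprod : ∀ s : Finset ℂ, (∀ ζ ∈ s, ζ ^ N = 1) → ∃ K : ℝ≥0, AntilipschitzWith K
      (Polynomial.aeval U (∏ ζ ∈ s, (Polynomial.X - Polynomial.C ζ))) := by
    classical
    intro s
    induction s using Finset.induction_on with
    | empty => exact fun _ => ⟨1, by simpa using AntilipschitzWith.id⟩
    | insert ζ s hζ ih =>
      intro hs
      obtain ⟨K₁, h₁⟩ := h ζ (hs ζ (Finset.mem_insert_self _ _))
      obtain ⟨K₂, h₂⟩ := ih fun z hz => hs z (Finset.mem_insert_of_mem hz)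
      rw [Finset.prod_insert hζ, map_mul, map_sub, Polynomial.aeval_X, Polynomial.aeval_C]
      exact ⟨_, h₁.comp h₂⟩
  obtain ⟨K, hK⟩ := hprod (Polynomial.nthRootsFinset N 1)
    fun ζ hζ => (Polynomial.mem_nthRootsFinset hN 1).1 hζ
  rw [← Polynomial.X_pow_sub_one_eq_prod hN (Complex.isPrimitiveRoot_exp N hN.ne')] at hK
  rw [map_sub, map_pow, Polynomial.aeval_X, map_one] at hK
  exact ⟨K, hK⟩

/-- For `θ ≠ 0` the integral has modulus `h |sin(θ/2)| / (|θ|/2)`, and Jordan's inequality applies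
because `|θ|/2 ≤ π/2`. -/
theorem two_div_pi_mul_le_norm_integral_exp {θ h : ℝ} (hθ : |θ| ≤ Real.pi) (hh : 0 < h) :
    2 / Real.pi * h ≤
      ‖∫ s in (0 : ℝ)..h, Complex.exp (-(Complex.I * θ / h * s))‖ := by
  rcases eq_or_ne θ 0 with rfl | h0
  · simp only [Complex.ofReal_zero, mul_zero, zero_div, zero_mul, neg_zero, Complex.exp_zero,
      intervalIntegral.integral_const, sub_zero, norm_smul, norm_one, mul_one, Real.norm_eq_abs,
      abs_of_pos hh]
    have : 2 / Real.pi ≤ 1 := (div_le_one Real.pi_pos).2 Real.two_le_pi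
    nlinarith
  · have hh' : (h : ℂ) ≠ 0 := by exact_mod_cast hh.ne'
    have hθ' : (θ : ℂ) ≠ 0 := by exact_mod_cast h0
    have hc : -(Complex.I * θ / h) ≠ 0 :=
      neg_ne_zero.2 (div_ne_zero (mul_ne_zero Complex.I_ne_zero hθ') hh')
    simp only [← neg_mul]
    rw [integral_exp_mul_complex hc]
    have e : -(Complex.I * θ / h) * h = Complex.I * ((-θ : ℝ) : ℂ) := by
      push_cast
      field_simp
    rw [e, Complex.ofReal_zero, mul_zero, Complex.exp_zero, norm_div,
      Complex.norm_exp_I_mul_ofReal_sub_one]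
    have hs : 2 / Real.pi * (|θ| / 2) ≤ |Real.sin (-θ / 2)| := by
      have h1 := Real.mul_le_sin (x := |θ| / 2) (by positivity) (by linarith)
      refine h1.trans ?_
      rcases abs_cases θ with ⟨h2, -⟩ | ⟨h2, -⟩ <;> rw [h2]
      · rw [neg_div, Real.sin_neg, abs_neg]; exact le_abs_self _
      · exact le_abs_self _
    have hpos : 0 < |θ| := abs_pos.2 h0
    simp only [norm_neg, norm_div, norm_mul, Complex.norm_I, one_mul, Complex.norm_real,
      Real.norm_eq_abs, abs_of_pos hh, abs_two]
    rw [le_div_iff₀ (by positivity)]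
    calc 2 / Real.pi * h * (|θ| / h) = 2 * (2 / Real.pi * (|θ| / 2)) := by field_simp
      _ ≤ _ := by gcongr

namespace C0Semigroup

variable {X : Type*} [NormedAddCommGroup X] [NormedSpace ℂ X]

theorem exp_smul_rescale_op_sub (T : C0Semigroup X) (t : ℝ≥0) (l : ℂ) (x : X) :
    Complex.exp (((t : ℝ) : ℂ) * l) • ((T.rescale l).op t x - x) =
      T.op t x - Complex.exp (((t : ℝ) : ℂ) * l) • x := by
  rw [smul_sub, rescale_op_apply, smul_smul, ← Complex.exp_add, mul_comm, add_neg_cancel,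
    Complex.exp_zero, one_smul]

theorem rescale_isBoundedComp (T : C0Semigroup X) {t₀ : ℝ≥0}
    (h : T.generator.IsBoundedComp (T.op t₀)) (l : ℂ) :
    ∃ B : X →L[ℂ] X, ∀ x, ((T.rescale l).op t₀ x, B x) ∈ (T.rescale l).generator.graph := by
  obtain ⟨B, hB⟩ := h
  refine ⟨Complex.exp (-(l * ((t₀ : ℝ) : ℂ))) • (B - l • T.op t₀), fun x => ?_⟩
  obtain ⟨h1, h2⟩ := hB x
  rw [generator_rescale]
  suffices hx : (T.op t₀ x, B x - l • T.op t₀ x) ∈ (T.generator.subScalar l).graph from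
    (T.generator.subScalar l).graph.smul_mem (Complex.exp (-(l * ((t₀ : ℝ) : ℂ)))) hx
  rw [LinearPMap.mem_graph_iff]
  refine ⟨⟨T.op t₀ x, h1⟩, rfl, ?_⟩
  change T.generator ⟨T.op t₀ x, h1⟩ - l • T.op t₀ x = B x - l • T.op t₀ x
  rw [h2]

variable [CompleteSpace X]

/-- `A T(b) = T(b - t₀) B` is bounded, so `T(s)T(b)x - T(b)x` is an integral over `[0, s]` of a
bounded orbit. -/
theorem exists_norm_op_sub_le (T : C0Semigroup X) {t₀ b : ℝ≥0} (hb : t₀ ≤ b) {B : X →L[ℂ] X}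
    (hB : ∀ x, (T.op t₀ x, B x) ∈ T.generator.graph) (a : ℝ≥0) :
    ∃ L : ℝ, 0 < L ∧ ∀ s ≤ a, ∀ x, ‖T.op s (T.op b x) - T.op b x‖ ≤ L * s * ‖x‖ := by
  obtain ⟨M, hM, hMb⟩ := T.exists_bound a
  refine ⟨M * (‖(T.op (b - t₀)).comp B‖ + 1), by positivity, fun s hs x => ?_⟩
  have h1 : (T.op b x, T.op (b - t₀) (B x)) ∈ T.generator.graph := by
    have := T.map_mem_graph_generator (S := T.op (b - t₀)) (fun s x => T.op_comm _ _ _) (hB x)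
    rwa [← op_add_apply, tsub_add_cancel_of_le hb] at this
  rw [← T.orbitIntegral_of_mem_graph s h1]
  have h2 := T.norm_orbitIntegral_le (a := s) (x := T.op (b - t₀) (B x))
    (C := M * ((‖(T.op (b - t₀)).comp B‖ + 1) * ‖x‖)) (fun u hu => by
      refine (T.op u).le_of_opNorm_le_of_le (hMb u (hu.trans hs)) ?_
      exact (((T.op (b - t₀)).comp B).le_opNorm x).trans (by gcongr; linarith))
  calc _ ≤ _ := h2
    _ = _ := by ring

/-- Replacing `T(s)z` by `z` in the integral costs at most `D h`, and what remains is a scalar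
integral times `z`. -/
theorem le_norm_orbitIntegral_rescale (T : C0Semigroup X) {h : ℝ≥0} (hh : 0 < h) {θ D : ℝ}
    (hθ : |θ| ≤ Real.pi) {z : X} (hD : ∀ s ≤ h, ‖T.op s z - z‖ ≤ D) :
    2 / Real.pi * h * ‖z‖ - D * h ≤
      ‖(T.rescale (Complex.I * θ / (h : ℝ))).orbitIntegral h z‖ := by
  set l : ℂ := Complex.I * θ / (h : ℝ) with hl
  have hexp : Continuous fun s : ℝ => Complex.exp (-(l * s)) := by fun_prop
  have hnorm : ∀ s : ℝ, ‖Complex.exp (-(l * s))‖ = 1 := by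
    intro s
    have : -(l * s) = ((-(θ / h * s) : ℝ) : ℂ) * Complex.I := by
      rw [hl]; push_cast; ring
    rw [this, Complex.norm_exp_ofReal_mul_I]
  have heq : (T.rescale l).orbitIntegral h z =
      (∫ s in (0 : ℝ)..h, Complex.exp (-(l * s))) • z +
      ∫ s in (0 : ℝ)..h, Complex.exp (-(l * s)) • (T.op s.toNNReal z - z) := by
    rw [← intervalIntegral.integral_smul_const, ← intervalIntegral.integral_add,
      orbitIntegral_apply]
    · refine intervalIntegral.integral_congr fun s hs => ?_
      rw [Set.uIcc_of_le h.coe_nonneg] at hs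
      simp only [rescale_op_apply, Real.coe_toNNReal s hs.1]
      module
    · exact (hexp.smul continuous_const).intervalIntegrable _ _
    · exact (hexp.smul ((T.continuous_orbit z).sub continuous_const)).intervalIntegrable _ _
  have herr : ‖∫ s in (0 : ℝ)..h, Complex.exp (-(l * s)) • (T.op s.toNNReal z - z)‖ ≤ D * h := by
    have := intervalIntegral.norm_integral_le_of_norm_le_const (a := (0 : ℝ)) (b := h)
      (f := fun s : ℝ => Complex.exp (-(l * s)) • (T.op s.toNNReal z - z)) (C := D)
      (fun s hs => by
        rw [Set.uIoc_of_le h.coe_nonneg] at hs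
        rw [norm_smul, hnorm, one_mul]
        exact hD _ (Real.toNNReal_le_iff_le_coe.2 hs.2))
    rwa [sub_zero, abs_of_nonneg h.coe_nonneg] at this
  have hmain := mul_le_mul_of_nonneg_right
    (two_div_pi_mul_le_norm_integral_exp hθ (NNReal.coe_pos.2 hh)) (norm_nonneg z)
  rw [← norm_smul] at hmain
  rw [heq]
  have h3 := norm_sub_norm_le ((∫ s in (0 : ℝ)..h, Complex.exp (-(l * s))) • z)
    (-∫ s in (0 : ℝ)..h, Complex.exp (-(l * s)) • (T.op s.toNNReal z - z))
  rw [sub_neg_eq_add, norm_neg] at h3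
  linarith

/-- With `z = T(kh)x`, the rescaled integral of `z` is bounded above by a multiple of `‖U x‖` and
below by `(2/π) h ‖z‖ - D h ‖x‖`; moreover `‖z‖ ≥ ‖x‖ - ‖Q‖ ‖U x‖`. The condition `D < 2/π` lets the
`‖x‖` terms be absorbed. -/
theorem exists_antilipschitzWith_op_sub (T : C0Semigroup X) {h : ℝ≥0} (hh : 0 < h) {θ D C : ℝ}
    (hθ : |θ| ≤ Real.pi) (hD : D < 2 / Real.pi) {k : ℕ}
    (hT : ∀ s ≤ h, ∀ x, ‖T.op s (T.op (k • h) x) - T.op (k • h) x‖ ≤ D * ‖x‖)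
    (hk : Complex.exp (Complex.I * θ) ^ k = 1) (hC : 0 < C)
    (hbb : ∀ x y, (x, y) ∈ (T.generator.subScalar (Complex.I * θ / (h : ℝ))).graph →
      ‖x‖ ≤ C * ‖y‖) :
    ∃ K : ℝ≥0, AntilipschitzWith K
      (T.op h - algebraMap ℂ (X →L[ℂ] X) (Complex.exp (Complex.I * θ))) := by
  set ζ := Complex.exp (Complex.I * θ) with hζ
  set U := T.op h - algebraMap ℂ (X →L[ℂ] X) ζ with hU
  have hUx : ∀ x, U x = T.op h x - ζ • x := fun x => by
    simp [hU, Algebra.algebraMap_eq_smul_one]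
  have hζn : ‖ζ‖ = 1 := by rw [hζ, mul_comm, Complex.norm_exp_ofReal_mul_I]
  have hh' : ((h : ℝ) : ℂ) ≠ 0 := by simpa using hh.ne'
  -- As `ζ^k = 1`, `T(kh) - 1 = T(h)^k - ζ^k` is divisible by `T(h) - ζ`.
  obtain ⟨Q, hQ⟩ : ∃ Q : X →L[ℂ] X, T.op (k • h) - 1 = Q * U := by
    have hc : Commute (T.op h) (algebraMap ℂ (X →L[ℂ] X) ζ) := (Algebra.commutes ζ (T.op h)).symm
    have hg := hc.geom_sum₂_mul k
    rw [← map_pow, hk, map_one, ← op_nsmul] at hg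
    exact ⟨_, hg.symm⟩
  have hlow : ∀ x, ‖x‖ ≤ ‖T.op (k • h) x‖ + ‖Q‖ * ‖U x‖ := fun x => by
    have h1 : T.op (k • h) x - x = Q (U x) := congrArg (fun S : X →L[ℂ] X => S x) hQ
    have h2 := Q.le_opNorm (U x)
    rw [← h1] at h2
    have h3 := norm_sub_norm_le x (T.op (k • h) x)
    rw [norm_sub_rev] at h3
    linarith
  have hupp : ∀ x, ‖(T.rescale (Complex.I * θ / (h : ℝ))).orbitIntegral h (T.op (k • h) x)‖ ≤
      C * (‖T.op (k • h)‖ * ‖U x‖) := fun x => by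
    have hmem := (T.rescale (Complex.I * θ / (h : ℝ))).orbitIntegral_mem_graph h (T.op (k • h) x)
    rw [generator_rescale] at hmem
    refine (hbb _ _ hmem).trans ?_
    gcongr
    have e : Complex.exp (-(Complex.I * θ / (h : ℝ) * (h : ℝ))) = ζ⁻¹ := by
      rw [div_mul_cancel₀ _ hh', Complex.exp_neg]
    have e2 : (T.rescale (Complex.I * θ / (h : ℝ))).op h (T.op (k • h) x) - T.op (k • h) x =
        ζ⁻¹ • T.op (k • h) (U x) := by
      rw [rescale_op_apply, e, hUx, map_sub, map_smul, smul_sub,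
        inv_smul_smul₀ (Complex.exp_ne_zero _), T.op_comm]
    rw [e2, norm_smul, norm_inv, hζn, inv_one, one_mul]
    exact (T.op (k • h)).le_opNorm _
  have hpos : 0 < (2 / Real.pi - D) * h := mul_pos (by linarith) (NNReal.coe_pos.2 hh)
  refine ⟨Real.toNNReal (((2 / Real.pi - D) * h)⁻¹ *
    (C * ‖T.op (k • h)‖ + 2 / Real.pi * h * ‖Q‖)),
    AddMonoidHomClass.antilipschitz_of_bound _ fun x => ?_⟩
  rw [Real.coe_toNNReal _ (by have := Real.pi_pos; positivity), mul_assoc,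
    ← div_eq_inv_mul, le_div_iff₀ hpos]
  have h1 := T.le_norm_orbitIntegral_rescale hh hθ (fun s hs => hT s hs x)
  have h2 := hupp x
  have h3 := mul_le_mul_of_nonneg_left (hlow x)
    (show 0 ≤ 2 / Real.pi * (h : ℝ) by have := Real.pi_pos; positivity)
  linarith

theorem exists_antilipschitzWith_op_sub_one (T : C0Semigroup X) {t₀ t : ℝ≥0} (ht : 0 < t)
    {B : X →L[ℂ] X} (hB : ∀ x, (T.op t₀ x, B x) ∈ T.generator.graph)
    (hbb : ∀ l : ℂ, Complex.exp (((t : ℝ) : ℂ) * l) = 1 →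
      ∃ C : ℝ, 0 < C ∧ ∀ x y, (x, y) ∈ (T.generator.subScalar l).graph → ‖x‖ ≤ C * ‖y‖) :
    ∃ K : ℝ≥0, AntilipschitzWith K (T.op t - 1 : X →L[ℂ] X) := by
  obtain ⟨m, hm⟩ := Archimedean.arch t₀ ht
  obtain ⟨L, hL, hLb⟩ := T.exists_norm_op_sub_le hm hB t
  -- `L` depends only on `t` and `m t ≥ t₀`, not on the step, so `N` can be taken large enough that
  -- `L t / N < 1/π`.
  obtain ⟨N, hN⟩ := exists_nat_gt (L * t * Real.pi)
  have hpi := Real.pi_pos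
  have hN0' : (0 : ℝ) < N := lt_of_le_of_lt (by positivity) hN
  have hN0 : 0 < N := by exact_mod_cast hN0'
  set h : ℝ≥0 := t / N with hh
  have hNh : N • h = t := by
    rw [hh, nsmul_eq_mul, mul_div_cancel₀]
    exact_mod_cast hN0.ne'
  have hhpos : 0 < h := div_pos ht (by exact_mod_cast hN0)
  have hht : h ≤ t := div_le_self ht.le (by exact_mod_cast hN0)
  have hkh : (m * N) • h = m • t := by rw [mul_smul, hNh]
  have key : ∃ K : ℝ≥0, AntilipschitzWith K (T.op h ^ N - 1 : X →L[ℂ] X) := by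
    refine exists_antilipschitzWith_pow_sub_one (T.op h) hN0 fun ζ hζ => ?_
    have hn : ‖ζ‖ = 1 := Complex.norm_eq_one_of_pow_eq_one hζ hN0.ne'
    have hζe : Complex.exp (Complex.I * ζ.arg) = ζ := by
      have := Complex.norm_mul_exp_arg_mul_I ζ
      rwa [hn, Complex.ofReal_one, one_mul, mul_comm] at this
    have hthc : ((t : ℝ) : ℂ) = N * ((h : ℝ) : ℂ) := by
      rw [← hNh]; push_cast; simp
    have hhc : ((h : ℝ) : ℂ) ≠ 0 := by simpa using hhpos.ne'
    -- With `λ = i arg ζ / h` one has `e^{hλ} = ζ`, so `e^{tλ} = ζ^N = 1`.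
    obtain ⟨C, hC, hCb⟩ := hbb (Complex.I * ζ.arg / (h : ℝ)) (by
      rw [← hζ, ← hζe, ← Complex.exp_nat_mul, hζe, hthc]
      congr 1
      field_simp)
    have := T.exists_antilipschitzWith_op_sub (θ := ζ.arg) (D := L * h) (k := m * N) hhpos
      (Complex.abs_arg_le_pi ζ) ?_ ?_ ?_ hC hCb
    · rwa [hζe] at this
    · have e : L * (h : ℝ) = L * t / N := by rw [hh]; push_cast; ring
      have : L * (h : ℝ) < 1 / Real.pi := by
        rw [e, div_lt_div_iff₀ hN0' hpi]
        linarith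
      refine this.trans ?_
      gcongr
      norm_num
    · intro s hs x
      rw [hkh]
      refine (hLb s (hs.trans hht) x).trans ?_
      gcongr
    · rw [hζe, mul_comm, pow_mul, hζ, one_pow]
  rwa [← op_nsmul, hNh] at key

/-! ### The two inclusions -/

theorem isSemiRegular_subScalar_of_op (T : C0Semigroup X) {t : ℝ≥0} (ht : 0 < t) {l : ℂ}
    (h : ((T.op t).asPMap.subScalar (Complex.exp (((t : ℝ) : ℂ) * l))).IsSemiRegular) :
    (T.generator.subScalar l).IsSemiRegular := by
  rw [← generator_rescale]
  refine (T.rescale l).isSemiRegular_generator ht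
    (c := Complex.exp (((t : ℝ) : ℂ) * l)) (fun x y => ?_) h (Complex.exp_ne_zero _)
  rw [ContinuousLinearMap.mem_graph_asPMap_subScalar, exp_smul_rescale_op_sub]

theorem isSemiRegular_op_of_subScalar (T : C0Semigroup X) {t₀ t : ℝ≥0} (ht : 0 < t)
    (hT : T.generator.IsBoundedComp (T.op t₀)) (hA : T.generator.HasSVEP) {l₀ : ℂ}
    (h : ∀ l, Complex.exp (((t : ℝ) : ℂ) * l) = Complex.exp (((t : ℝ) : ℂ) * l₀) →
      (T.generator.subScalar l).IsSemiRegular) :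
    ((T.op t).asPMap.subScalar (Complex.exp (((t : ℝ) : ℂ) * l₀))).IsSemiRegular := by
  obtain ⟨B, hB⟩ := T.rescale_isBoundedComp hT l₀
  obtain ⟨K, hK⟩ := (T.rescale l₀).exists_antilipschitzWith_op_sub_one ht hB fun l hl => by
    rw [generator_rescale, LinearPMap.subScalar_subScalar]
    refine LinearPMap.bounded_below_of_hasSVEPAt ?_ (h _ ?_) (hA _)
    · rw [← generator_rescale]
      exact isClosed_generator _
    · rw [mul_add, Complex.exp_add, hl, mul_one]
  refine (T.op t).isSemiRegular_of_bounded_below _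
    (C := K * ‖Complex.exp (((t : ℝ) : ℂ) * l₀)‖⁻¹) fun x => ?_
  rw [← exp_smul_rescale_op_sub, norm_smul, mul_assoc,
    inv_mul_cancel_left₀ (norm_ne_zero_iff.2 (Complex.exp_ne_zero _))]
  simpa [dist_eq_norm] using hK.le_mul_dist x 0

end C0Semigroup

theorem mainTheorem7 {X : Type*} [NormedAddCommGroup X] [NormedSpace ℂ X] [CompleteSpace X]
    (hX : IsReflexiveSpace X) (T : C0Semigroup X)
    (hT : ∃ t₀ : ℝ≥0, 0 < t₀ ∧ T.generator.IsBoundedComp (T.op t₀))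
    (hA : T.generator.HasSVEP) (t : ℝ≥0) (ht : 0 < t) :
    (fun z : ℂ => Complex.exp (((t : ℝ) : ℂ) * z)) '' T.generator.katoSpectrum =
      (T.op t).asPMap.katoSpectrum \ {0} := by
  obtain ⟨t₀, -, hT⟩ := hT
  ext m
  constructor
  · rintro ⟨l, hl, rfl⟩
    exact ⟨fun h => hl (T.isSemiRegular_subScalar_of_op ht h), Complex.exp_ne_zero _⟩
  · rintro ⟨hm, hm0⟩
    have ht' : ((t : ℝ) : ℂ) ≠ 0 := by simpa using ht.ne'
    obtain ⟨l₀, rfl⟩ : ∃ l₀, Complex.exp (((t : ℝ) : ℂ) * l₀) = m :=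
      ⟨Complex.log m / ((t : ℝ) : ℂ), by rw [mul_div_cancel₀ _ ht', Complex.exp_log hm0]⟩
    by_contra hne
    refine hm (T.isSemiRegular_op_of_subScalar ht hT hA fun l hl => ?_)
    by_contra hl'
    exact hne ⟨l, hl', hl⟩
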